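/- A \emph{gauge function} is a continuous nondecreasing function $g:[0,\infty)\to[0,\infty)$ with $g(\delta)=0$ iff $\delta=0$. A \emph{gauge family} is a family $\varphi=\{\varphi_s\}_{s\in(0,\infty)}$ of gauge functions with $\varphi_s(\delta)=o(\varphi_t(\delta))$ as $\delta\to0^+$ whenever $s>t$. Its \emph{jump} is $\widetilde\varphi_s(\delta)=2^{-1/\varphi_s(\delta)}$ for $\delta>0$, $\widetilde\varphi_s(0)=0$. A \emph{precision family} for $\varphi$ is a family $\{\alpha_s\}_{s\in(0,\infty)}$ of functions $\alpha_s:\mathbb N\to\mathbb Q^+$ with $\alpha_s(r)\to0$ and $\varphi_s(\alpha_s(r))=O(\varphi_s(\alpha_s(r+1)))$ as $r\to\infty$, and $\sum_{r\in\mathbb N}\varphi_t(\alpha_s(r))/\varphi_s(\alpha_s(r))<\infty$ whenever $s<t$. Let $Y$ be a metric space and $E\subseteq Y$. For a gauge function $g$ and $\delta>0$, let $P^g_\delta(E)$ be the supremum of $\sum_i g(2r_i)$ over all countable collections of pairwise disjoint open balls $B_{r_i}(x_i)$ of $Y$ with $x_i\in E$, $r_i>0$ and $2r_i\le\delta$ (the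 diameter of a ball is taken to be twice its radius). Put $P^g_0(E)=\lim_{\delta\to0^+}P^g_\delta(E)$ and $P^g(E)=\inf\{\sum_{U\in\mathcal U}P^g_0(U)\mid\mathcal U\text{ a countable cover of }E\}$. The \emph{$\varphi$-gauged packing dimension} is $\dim_{\mathrm P}^{\varphi}(E)=\inf\{s\in(0,\infty)\mid P^{\varphi_s}(E)=0\}$. With $N(E,\delta)$ the least cardinality of a set $F\subseteq Y$ such that $E\subseteq\bigcup_{x\in F}B_\delta(x)$, the \emph{$\varphi$-gauged upper Minkowski dimension} is $\overline{\dim}_{\mathcal M}^{\varphi}(E)=\inf\{s\in(0,\infty)\mid\limsup_{\delta\to0^+}N(E,\delta)\varphi_s(\delta)=0\}$. Both take values in $[0,\infty]$, with $\inf\emptyset=\infty$. \textbf{Theorem.} Let $X$ be a separable metric space, let $E\subseteq X$ be compact, and let $\varphi$ be a gauge family such that $\varphi_t(2\delta)=O(\varphi_s(\delta))$ as $\delta\to0^+$ for all $0<s<t$ and such that there is a precision family for $\varphi$. Let $\mathcal K(X)$ be the space of nonempty compact subsets of $X$ with the Hausdorff metric, and let $\mathcal K(E)\subseteq\mathcal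 K(X)$ be the set of nonempty compact subsets of $E$. Then \[\dim_{\mathrm P}^{\widetilde\varphi}(\mathcal K(E))=\overline{\dim}_{\mathcal M}^{\widetilde\varphi}(\mathcal K(E)).\] -/

import Mathlib

open Filter Topology Asymptotics TopologicalSpace
open scoped NNReal ENNReal

/-- A gauge function: a continuous nondecreasing function from `[0, ∞)` to `[0, ∞)` that
vanishes only at `0`. -/
structure IsGauge (g : ℝ≥0 → ℝ≥0) : Prop where
  continuous : Continuous g
  monotone : Monotone g
  eq_zero_iff : ∀ δ, g δ = 0 ↔ δ = 0

/-- A gauge family `φ = {φ_s | s ∈ (0, ∞)}`: each `φ_s` is a gauge function, and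
`φ_s(δ) = o(φ_t(δ))` as `δ → 0⁺` whenever `s > t`. Values of `φ` at the index `0` are
never used. -/
structure IsGaugeFamily (φ : ℝ≥0 → ℝ≥0 → ℝ≥0) : Prop where
  isGauge : ∀ s, 0 < s → IsGauge (φ s)
  isLittleO : ∀ s t, 0 < t → t < s →
    (fun δ : ℝ≥0 => (φ s δ : ℝ)) =o[𝓝[>] 0] fun δ : ℝ≥0 => (φ t δ : ℝ)

/-- The condition `φ_t(2δ) = O(φ_s(δ))` as `δ → 0⁺` for all `s < t`. -/
def IsDoublingFamily (φ : ℝ≥0 → ℝ≥0 → ℝ≥0) : Prop :=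
  ∀ s t, 0 < s → s < t →
    (fun δ : ℝ≥0 => (φ t (2 * δ) : ℝ)) =O[𝓝[>] 0] fun δ : ℝ≥0 => (φ s δ : ℝ)

/-- A precision sequence for a gauge function `g`: positive rationals `a r` tending to `0`
with `g (a r) = O(g (a (r + 1)))` as `r → ∞`. -/
structure IsPrecisionSequence (g : ℝ≥0 → ℝ≥0) (a : ℕ → ℚ≥0) : Prop where
  pos : ∀ r, 0 < a r
  tendsto_zero : Tendsto (fun r => (a r : ℝ≥0)) atTop (𝓝 0)
  isBigO : (fun r => (g (a r) : ℝ)) =O[atTop] fun r => (g (a (r + 1)) : ℝ)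

/-- A precision family for a gauge family `φ`: precision sequences `α_s` for `φ_s`,
`s ∈ (0, ∞)`, such that `∑_r φ_t(α_s(r)) / φ_s(α_s(r)) < ∞` whenever `s < t`. -/
structure IsPrecisionFamily (φ : ℝ≥0 → ℝ≥0 → ℝ≥0) (α : ℝ≥0 → ℕ → ℚ≥0) : Prop where
  isPrecisionSequence : ∀ s, 0 < s → IsPrecisionSequence (φ s) (α s)
  summable : ∀ s t, 0 < s → s < t → Summable fun r => φ t (α s r) / φ s (α s r)

/-- The jump of a gauge family, `δ ↦ 2 ^ (-1 / φ_s(δ))`, with value `0` where `φ_s(δ) = 0`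
(that is, at `δ = 0`). -/
noncomputable def jump (φ : ℝ≥0 → ℝ≥0 → ℝ≥0) (s δ : ℝ≥0) : ℝ≥0 :=
  if φ s δ = 0 then 0 else (2 : ℝ≥0) ^ (-1 / (φ s δ : ℝ))

section Dimensions

variable {Y : Type*} [MetricSpace Y]

/-- `C`, a set of pairs (center, radius), is a countable collection of pairwise disjoint open
balls of `Y` with centers in `E` and diameters at most `δ`, where the diameter of the ball of
radius `r` is `2 * r`. -/
structure IsBallPacking (E : Set Y) (δ : ℝ≥0) (C : Set (Y × ℝ≥0)) : Prop where
  countable : C.Countable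
  center_mem : ∀ p ∈ C, p.1 ∈ E
  radius_pos : ∀ p ∈ C, 0 < p.2
  diam_le : ∀ p ∈ C, 2 * p.2 ≤ δ
  disjoint : C.PairwiseDisjoint fun p => Metric.ball p.1 (p.2 : ℝ)

/-- `P_δ^g(E)`: the supremum of `∑ g(diameter)` over packings by balls of diameter `≤ δ`. -/
noncomputable def packingSup (g : ℝ≥0 → ℝ≥0) (δ : ℝ≥0) (E : Set Y) : ℝ≥0∞ :=
  ⨆ (C : Set (Y × ℝ≥0)) (_ : IsBallPacking E δ C), ∑' p : C, (g (2 * p.1.2) : ℝ≥0∞)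

/-- The packing pre-measure: the limit as `δ → 0⁺` of `packingSup g δ E`, which is
nondecreasing in `δ`, so that the limit is the infimum over `δ > 0`. -/
noncomputable def packingPremeasure (g : ℝ≥0 → ℝ≥0) (E : Set Y) : ℝ≥0∞ :=
  ⨅ (δ : ℝ≥0) (_ : 0 < δ), packingSup g δ E

/-- The packing measure: the infimum of `∑ P_0(U)` over countable covers of `E`. -/
noncomputable def packingMeasure (g : ℝ≥0 → ℝ≥0) (E : Set Y) : ℝ≥0∞ :=
  ⨅ (𝒰 : Set (Set Y)) (_ : 𝒰.Countable) (_ : E ⊆ ⋃₀ 𝒰), ∑' U : 𝒰, packingPremeasure g U.1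

/-- The `φ`-gauged packing dimension of `E`, with values in `[0, ∞]`. -/
noncomputable def packingDim (φ : ℝ≥0 → ℝ≥0 → ℝ≥0) (E : Set Y) : ℝ≥0∞ :=
  ⨅ (s : ℝ≥0) (_ : 0 < s) (_ : packingMeasure (φ s) E = 0), (s : ℝ≥0∞)

/-- `N(E, δ)`: the least cardinality of a set `F ⊆ Y` such that the open balls of radius `δ`
centered in `F` cover `E` (`⊤` if there is no finite such set). -/
noncomputable def coverNumber (E : Set Y) (δ : ℝ≥0) : ℕ∞ :=
  ⨅ (F : Set Y) (_ : E ⊆ ⋃ x ∈ F, Metric.ball x (δ : ℝ)), F.encard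

/-- The `φ`-gauged upper Minkowski dimension of `E`, with values in `[0, ∞]`. -/
noncomputable def upperMinkowskiDim (φ : ℝ≥0 → ℝ≥0 → ℝ≥0) (E : Set Y) : ℝ≥0∞ :=
  ⨅ (s : ℝ≥0) (_ : 0 < s)
    (_ : limsup (fun δ : ℝ≥0 => (coverNumber E δ : ℝ≥0∞) * (φ s δ : ℝ≥0∞)) (𝓝[>] 0) = 0),
    (s : ℝ≥0∞)

/-- `𝒦(E)`: the set of nonempty compact subsets of `E`, as a subset of the hyperspace of `Y`,
which is `NonemptyCompacts Y` with Mathlib's Hausdorff metric. -/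
def hyperspace (E : Set Y) : Set (NonemptyCompacts Y) :=
  {L | (L : Set Y) ⊆ E}

end Dimensions

/-! Both dimensions of `hyperspace E` equal `upperMinkowskiDim φ E`, by a cycle of three
inequalities.

Packing ≤ Minkowski, for any set and the jump family: sort the balls of a packing by the scales of a
precision sequence. At each scale their number is at most a covering number, and the exponential
form of the jump turns slack between indices into a summable bound
(`packingPremeasure_jump_eq_zero`).

Minkowski of `hyperspace E` ≤ Minkowski of `E`: if `n` balls cover `E`, the nonempty subsets of
their centers give at most `2 ^ n` balls covering `hyperspace E`.

Minkowski of `E` ≤ packing of `hyperspace E`: if covering numbers are large, compactness localizes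
this at a point `p`. By Baire, a member `U` of any countable cover is dense near some `L₀` among the
compact subsets of `E` containing `p`. Adding to a finite net of `L₀` arbitrary subsets of a
separated set near `p` yields exponentially many separated points of `closure U`, so the premeasure
of `U` is at least 1. -/

section Jump

/-! ### Elementary properties of the jump. -/

variable {φ : ℝ≥0 → ℝ≥0 → ℝ≥0}

theorem jump_of_pos {s δ : ℝ≥0} (h : 0 < φ s δ) : jump φ s δ = (2 : ℝ≥0) ^ (-1 / (φ s δ : ℝ)) := by
  rw [jump, if_neg h.ne']

theorem IsGaugeFamily.pos (hφ : IsGaugeFamily φ) {s δ : ℝ≥0} (hs : 0 < s) (hδ : 0 < δ) :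
    0 < φ s δ :=
  pos_iff_ne_zero.2 fun h => hδ.ne' (((hφ.isGauge s hs).eq_zero_iff δ).1 h)

theorem IsGaugeFamily.jump_mono (hφ : IsGaugeFamily φ) {s : ℝ≥0} (hs : 0 < s) {δ ε : ℝ≥0}
    (hδ : 0 < δ) (h : δ ≤ ε) : jump φ s δ ≤ jump φ s ε := by
  have h1 := hφ.pos hs hδ
  have h2 := hφ.pos hs (hδ.trans_le h)
  rw [jump_of_pos h1, jump_of_pos h2]
  refine NNReal.rpow_le_rpow_of_exponent_le one_le_two ?_
  rw [neg_div, neg_div, neg_le_neg_iff]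
  have h3 : (φ s δ : ℝ) ≤ φ s ε := mod_cast (hφ.isGauge s hs).monotone h
  exact one_div_le_one_div_of_le (mod_cast h1) h3

theorem IsGaugeFamily.tendsto_zero (hφ : IsGaugeFamily φ) {s : ℝ≥0} (hs : 0 < s) :
    Tendsto (fun δ => (φ s δ : ℝ)) (𝓝[>] 0) (𝓝 0) := by
  have h := hφ.isGauge s hs
  have h0 : φ s 0 = 0 := (h.eq_zero_iff 0).2 rfl
  have h1 : Tendsto (φ s) (𝓝[>] 0) (𝓝 0) := by
    simpa [h0] using (h.continuous.tendsto 0).mono_left nhdsWithin_le_nhds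
  exact NNReal.tendsto_coe.2 h1

theorem IsGaugeFamily.jump_tendsto_zero (hφ : IsGaugeFamily φ) {s c : ℝ≥0} (hs : 0 < s)
    (hc : 0 < c) :
    Tendsto (fun δ => ENNReal.ofReal ((2 : ℝ) ^ (-(c / φ s δ : ℝ)))) (𝓝[>] 0) (𝓝 0) := by
  have h1 : Tendsto (fun δ => (φ s δ : ℝ)) (𝓝[>] 0) (𝓝[>] 0) :=
    tendsto_nhdsWithin_iff.2 ⟨hφ.tendsto_zero hs, by
      filter_upwards [self_mem_nhdsWithin] with δ hδ
      exact Set.mem_Ioi.2 (mod_cast hφ.pos hs hδ)⟩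
  have h2 : Tendsto (fun δ => (c / φ s δ : ℝ)) (𝓝[>] 0) atTop :=
    (tendsto_inv_nhdsGT_zero.comp h1).const_mul_atTop (r := (c : ℝ)) (mod_cast hc)
  have h3 := (tendsto_rpow_atBot_of_base_gt_one 2 one_lt_two).comp (tendsto_neg_atTop_atBot.comp h2)
  simpa using ENNReal.tendsto_ofReal h3

theorem coe_jump_eq_ofReal {s δ : ℝ≥0} (h : 0 < φ s δ) :
    (jump φ s δ : ℝ≥0∞) = ENNReal.ofReal ((2 : ℝ) ^ (-(1 / φ s δ : ℝ))) := by
  rw [jump_of_pos h, ENNReal.ofReal, ENNReal.coe_inj, Real.toNNReal_rpow_of_nonneg zero_le_two,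
    neg_div]
  simp

end Jump

/-! ### Packings bounded by covering numbers. -/

section Packing

variable {Y : Type*} [MetricSpace Y]

theorem packingMeasure_le_packingPremeasure (g : ℝ≥0 → ℝ≥0) (A : Set Y) :
    packingMeasure g A ≤ packingPremeasure g A :=
  (iInf₂_le {A} (Set.countable_singleton A)).trans ((iInf_le _ (by simp)).trans (by simp))

/-- A point of `F` within `ρ` of a packing center lies in that packing ball, so disjointness makes
the choice of such points injective. -/
theorem IsBallPacking.encard_le_coverNumber {A : Set Y} {δ ρ : ℝ≥0} {C : Set (Y × ℝ≥0)}
    (hC : IsBallPacking A δ C) (hρ : ∀ p ∈ C, ρ ≤ p.2) : C.encard ≤ coverNumber A ρ := by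
  refine le_iInf₂ fun F hF => ?_
  rcases C.eq_empty_or_nonempty with rfl | ⟨p₀, -⟩
  · simp
  have : Nonempty Y := ⟨p₀.1⟩
  have h : ∀ p ∈ C, ∃ x ∈ F, dist p.1 x < ρ := fun p hp => by
    simpa using hF (hC.center_mem p hp)
  choose! f hfF hf using h
  refine Set.encard_le_encard_of_injOn (f := f) hfF fun p hp q hq hpq => ?_
  by_contra hne
  have h1 : f p ∈ Metric.ball p.1 (p.2 : ℝ) :=
    Metric.mem_ball'.2 ((hf p hp).trans_le (mod_cast hρ p hp))
  have h2 : f p ∈ Metric.ball q.1 (q.2 : ℝ) :=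
    hpq ▸ Metric.mem_ball'.2 ((hf q hq).trans_le (mod_cast hρ q hq))
  exact Set.disjoint_left.1 (hC.disjoint hp hq hne) h1 h2

theorem IsBallPacking.mono {A : Set Y} {δ : ℝ≥0} {C D : Set (Y × ℝ≥0)}
    (hC : IsBallPacking A δ C) (h : D ⊆ C) : IsBallPacking A δ D :=
  ⟨hC.countable.mono h, fun p hp => hC.center_mem p (h hp), fun p hp => hC.radius_pos p (h hp),
    fun p hp => hC.diam_le p (h hp), hC.disjoint.subset h⟩

/-- Sorting the balls of a packing by a sequence of scales `a r`. -/
theorem packingSup_le_tsum {A : Set Y} {g : ℝ≥0 → ℝ≥0}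
    (hg : ∀ δ ε, 0 < δ → δ ≤ ε → g δ ≤ g ε) {a : ℕ → ℝ≥0} (ha : Tendsto a atTop (𝓝 0))
    {R : ℕ} {δ : ℝ≥0} (hδ : ∀ r ≤ R, δ ≤ a r) :
    packingSup g δ A ≤ ∑' r, (coverNumber A (a (r + R + 1) / 2) : ℝ≥0∞) * g (a (r + R)) := by
  refine iSup₂_le fun C hC => ?_
  have key : ∀ p : C, ∃ r, a (r + R + 1) < 2 * p.1.2 ∧ 2 * p.1.2 ≤ a (r + R) := by
    intro p
    have hp : 0 < 2 * p.1.2 := mul_pos two_pos (hC.radius_pos _ p.2)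
    have hex : ∃ r, a (r + R + 1) < 2 * p.1.2 := by
      have := (tendsto_add_atTop_iff_nat (R + 1)).2 ha
      exact (this.eventually_lt_const hp).exists
    classical
    -- The sequence `a` need not be monotone; taking the first index that works forces the upper
    -- bound at the preceding one.
    refine ⟨Nat.find hex, Nat.find_spec hex, ?_⟩
    rcases h : Nat.find hex with _ | m
    · exact (hC.diam_le _ p.2).trans (by simpa using hδ R le_rfl)
    · have := Nat.find_min hex (m := m) (by omega)
      rw [not_lt] at this
      rwa [show m + 1 + R = m + R + 1 by ring]
  choose k hk1 hk2 using key
  rw [← ENNReal.tsum_fiberwise _ k]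
  refine ENNReal.tsum_le_tsum fun r => ?_
  calc ∑' p : k ⁻¹' {r}, (g (2 * p.1.1.2) : ℝ≥0∞)
      ≤ ∑' _ : k ⁻¹' {r}, (g (a (r + R)) : ℝ≥0∞) := by
        refine ENNReal.tsum_le_tsum fun p => ?_
        have hp : k p.1 = r := p.2
        have h2 := hk2 p.1
        rw [hp] at h2
        exact mod_cast hg _ _ (mul_pos two_pos (hC.radius_pos _ p.1.2)) h2
    _ = ((k ⁻¹' {r}).encard : ℝ≥0∞) * g (a (r + R)) := ENNReal.tsum_set_const _ _
    _ ≤ _ := by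
        gcongr
        rw [← Subtype.val_injective.encard_image]
        refine (hC.mono (D := Subtype.val '' (k ⁻¹' {r})) (by simp)).encard_le_coverNumber ?_
        rintro _ ⟨p, hp, rfl⟩
        have h1 := hk1 p
        rw [show k p = r from hp] at h1
        exact (NNReal.div_le_of_le_mul (by rw [mul_comm]; exact h1.le))

end Packing

/-! ### Packing dimension is at most upper Minkowski dimension for jumps. -/

theorem two_rpow_neg_one_div_le {y : ℝ} (hy : 0 < y) : (2 : ℝ) ^ (-(1 / y)) ≤ y := by
  have h : 1 / y ≤ (2 : ℝ) ^ (1 / y) := by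
    rcases le_total 1 (1 / y) with h | h
    · have := one_add_mul_self_le_rpow_one_add (s := 1) (by norm_num) h
      norm_num at this ⊢
      linarith
    · exact h.trans (Real.one_le_rpow one_le_two (by positivity))
  rw [Real.rpow_neg zero_le_two]
  exact inv_le_of_inv_le₀ hy (by rwa [← one_div])

/-- A factor 2 between gauge values becomes a decaying factor after the jump: `1/x - 1/y ≤ -1/(2y)`,
and `2^(-1/(2y)) ≤ 2y`. -/
theorem mul_two_rpow_le {N : ℝ≥0∞} {x y : ℝ} (hy : 0 < y) (hxy : 2 * y ≤ x)
    (h : N * ENNReal.ofReal (2 ^ (-(1 / x))) ≤ 1) :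
    N * ENNReal.ofReal (2 ^ (-(1 / y))) ≤ ENNReal.ofReal (2 * y) := by
  have hx : 0 < x := by linarith
  calc N * ENNReal.ofReal (2 ^ (-(1 / y)))
      = N * ENNReal.ofReal (2 ^ (-(1 / x))) * ENNReal.ofReal (2 ^ (1 / x - 1 / y)) := by
        rw [mul_assoc, ← ENNReal.ofReal_mul (by positivity), ← Real.rpow_add two_pos]
        ring_nf
    _ ≤ 1 * ENNReal.ofReal (2 * y) := by
        gcongr
        refine le_trans ?_ (two_rpow_neg_one_div_le (by positivity))
        refine Real.rpow_le_rpow_of_exponent_le one_le_two ?_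
        have : 1 / x ≤ 1 / (2 * y) := one_div_le_one_div_of_le (by positivity) hxy
        have : 1 / y = 2 * (1 / (2 * y)) := by field_simp
        linarith
    _ = _ := one_mul _

theorem tendsto_zero_of_limsup_eq_zero {ι : Type*} {l : Filter ι} {f : ι → ℝ≥0∞}
    (h : limsup f l = 0) : Tendsto f l (𝓝 0) :=
  tendsto_of_le_liminf_of_limsup_le bot_le h.le

section

variable {Y : Type*} [MetricSpace Y]

theorem packingDim_le_of_forall_gt {φ : ℝ≥0 → ℝ≥0 → ℝ≥0} {A : Set Y} {s : ℝ≥0}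
    (h : ∀ t, s < t → packingMeasure (φ t) A = 0) : packingDim φ A ≤ s := by
  refine ENNReal.le_of_forall_pos_le_add fun ε hε _ => ?_
  have hs : s < s + ε := lt_add_of_pos_right s hε
  exact (iInf₂_le (s + ε) (bot_le.trans_lt hs)).trans ((iInf_le _ (h _ hs)).trans (by simp))

theorem upperMinkowskiDim_le_of_forall_gt {φ : ℝ≥0 → ℝ≥0 → ℝ≥0} {A : Set Y} {s : ℝ≥0}
    (h : ∀ t, s < t →
      Tendsto (fun δ : ℝ≥0 => (coverNumber A δ : ℝ≥0∞) * (φ t δ : ℝ≥0∞)) (𝓝[>] 0) (𝓝 0)) :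
    upperMinkowskiDim φ A ≤ s := by
  refine ENNReal.le_of_forall_pos_le_add fun ε hε _ => ?_
  have hs : s < s + ε := lt_add_of_pos_right s hε
  exact (iInf₂_le (s + ε) (bot_le.trans_lt hs)).trans
    ((iInf_le _ (h _ hs).limsup_eq).trans (by simp))

variable {φ : ℝ≥0 → ℝ≥0 → ℝ≥0}

/-- With `s < u < t` and scales `a = α u`, doubling and precision give `φ u (a r) = O(φ s (a (r+1) /
2))`, hence eventually `2 φ t (a r) ≤ φ s (a (r+1) / 2)`. By `mul_two_rpow_le` the `r`-th term of
`packingSup_le_tsum` is then at most `2 φ t (a r) ≤ 2 φ t (a r) / φ u (a r)`, the tail of a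
convergent series. -/
theorem packingPremeasure_jump_eq_zero (hφ : IsGaugeFamily φ) (hdbl : IsDoublingFamily φ)
    {α : ℝ≥0 → ℕ → ℚ≥0} (hα : IsPrecisionFamily φ α) {A : Set Y} {s t : ℝ≥0} (hs : 0 < s)
    (hst : s < t)
    (h : Tendsto (fun δ : ℝ≥0 => (coverNumber A δ : ℝ≥0∞) * (jump φ s δ : ℝ≥0∞)) (𝓝[>] 0) (𝓝 0)) :
    packingPremeasure (jump φ t) A = 0 := by
  obtain ⟨u, hsu, hut⟩ := exists_between hst
  have hu : 0 < u := hs.trans hsu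
  have ht : 0 < t := hs.trans hst
  set a : ℕ → ℝ≥0 := fun r => (α u r : ℝ≥0) with ha_def
  have hP := hα.isPrecisionSequence u hu
  have ha_pos : ∀ r, 0 < a r := fun r => by
    simpa [ha_def] using hP.pos r
  have ha : Tendsto a atTop (𝓝 0) := hP.tendsto_zero
  have ha' : Tendsto a atTop (𝓝[>] 0) :=
    tendsto_nhdsWithin_iff.2 ⟨ha, Eventually.of_forall ha_pos⟩
  have hb : Tendsto (fun r => a (r + 1) / 2) atTop (𝓝[>] 0) := by
    refine tendsto_nhdsWithin_iff.2 ⟨?_, Eventually.of_forall fun r => half_pos (ha_pos _)⟩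
    simpa using ((tendsto_add_atTop_iff_nat 1).2 ha).div_const 2
  have ev1 := (h.comp hb).eventually_le_const zero_lt_one
  have hO : (fun r => (φ u (a r) : ℝ)) =O[atTop] fun r => (φ s (a (r + 1) / 2) : ℝ) := by
    refine hP.isBigO.trans ?_
    have := (hdbl s u hs hsu).comp_tendsto hb
    refine this.congr_left fun r => ?_
    simp only [Function.comp]
    rw [mul_div_cancel₀ _ two_ne_zero]
  obtain ⟨K, hK, hO⟩ := hO.exists_pos
  have ev2 := hO.bound
  -- The constant cancels `K` from `ev2` and leaves the factor 2 needed by `mul_two_rpow_le`.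
  have ev3 := ((hφ.isLittleO t u hu hut).comp_tendsto ha').bound (c := 1 / (2 * K)) (by positivity)
  have ev4 := ((hφ.tendsto_zero hu).comp ha').eventually_le_const zero_lt_one
  have hsum : Tendsto (fun R => ∑' r, ((2 * (φ t (a (r + R)) / φ u (a (r + R))) : ℝ≥0) : ℝ≥0∞))
      atTop (𝓝 0) := by
    have h1 := (hα.summable u t hu hut).mul_left 2
    exact ENNReal.tendsto_sum_nat_add
      (fun r => ((2 * (φ t (a r) / φ u (a r)) : ℝ≥0) : ℝ≥0∞)) (ENNReal.tsum_coe_ne_top_iff_summable.2 h1)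
  refine le_antisymm (ENNReal.le_of_forall_pos_le_add fun ε hε _ => ?_) bot_le
  obtain ⟨R₀, hR₀⟩ := eventually_atTop.1 ((ev1.and ev2).and (ev3.and ev4))
  obtain ⟨R, hR1, hR⟩ := ((hsum.eventually_le_const (u := (ε : ℝ≥0∞)) (by simpa using hε)).and
    (eventually_ge_atTop R₀)).exists
  obtain ⟨δ, hδ, hδR⟩ : ∃ δ, 0 < δ ∧ ∀ r ≤ R, δ ≤ a r := by
    obtain ⟨r₀, -, hr₀⟩ := (Finset.range (R + 1)).exists_min_image a ⟨0, by simp⟩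
    exact ⟨a r₀, ha_pos _, fun r hr => hr₀ r (by simpa [Nat.lt_succ_iff] using hr)⟩
  refine (iInf₂_le δ hδ).trans ((packingSup_le_tsum (fun δ ε => hφ.jump_mono ht) ha hδR).trans ?_)
  rw [zero_add]
  refine le_trans (ENNReal.tsum_le_tsum fun r => ?_) hR1
  obtain ⟨⟨h1, h2⟩, h3, h4⟩ := hR₀ (r + R) (hR.trans (Nat.le_add_left R r))
  have p1 := hφ.pos ht (ha_pos (r + R))
  have p2 := hφ.pos hu (ha_pos (r + R))
  have p3 := hφ.pos hs (half_pos (ha_pos (r + R + 1)))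
  simp only [Function.comp_apply, NNReal.norm_eq] at h1 h2 h3 h4
  rw [coe_jump_eq_ofReal p3] at h1
  rw [coe_jump_eq_ofReal p1]
  refine (mul_two_rpow_le (mod_cast p1) ?_ h1).trans ?_
  · have := mul_le_mul_of_nonneg_left h2 (show 0 ≤ 1 / K by positivity)
    have e1 : 1 / K * (K * (φ s (a (r + R + 1) / 2) : ℝ)) = φ s (a (r + R + 1) / 2) := by
      field_simp
    have e2 : 1 / (2 * K) * (φ u (a (r + R)) : ℝ) = 1 / K * φ u (a (r + R)) / 2 := by
      field_simp
    linarith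
  · rw [← ENNReal.ofReal_coe_nnreal]
    refine ENNReal.ofReal_le_ofReal ?_
    push_cast
    have : (φ t (a (r + R)) : ℝ) ≤ φ t (a (r + R)) / φ u (a (r + R)) :=
      le_div_self (by positivity) (mod_cast p2) h4
    linarith

theorem packingDim_jump_le_upperMinkowskiDim (hφ : IsGaugeFamily φ) (hdbl : IsDoublingFamily φ)
    {α : ℝ≥0 → ℕ → ℚ≥0} (hα : IsPrecisionFamily φ α) (A : Set Y) :
    packingDim (jump φ) A ≤ upperMinkowskiDim (jump φ) A := by
  refine le_iInf₂ fun s hs => le_iInf fun h => packingDim_le_of_forall_gt fun t hst => ?_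
  exact le_antisymm ((packingMeasure_le_packingPremeasure _ _).trans
    (packingPremeasure_jump_eq_zero hφ hdbl hα hs hst (tendsto_zero_of_limsup_eq_zero h)).le) bot_le

end

/-! ### Covering the hyperspace. -/

section

variable {X : Type*} [MetricSpace X]

theorem hausdorffDist_lt_of_subset_biUnion {L : Set X} (hL : IsCompact L) (hne : L.Nonempty)
    {F : Set X} (hF : F.Finite) {δ : ℝ} (h1 : L ⊆ ⋃ x ∈ F, Metric.ball x δ)
    (h2 : ∀ x ∈ F, ∃ y ∈ L, dist x y < δ) : Metric.hausdorffDist L F < δ := by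
  have hF' : F.Nonempty := by
    obtain ⟨y, hy⟩ := hne
    obtain ⟨x, hx, -⟩ := Set.mem_iUnion₂.1 (h1 hy)
    exact ⟨x, hx⟩
  -- Attained maxima keep the inequality strict, as open balls require.
  obtain ⟨y₀, hy₀, hmax⟩ := hL.exists_isMaxOn hne (Metric.continuous_infDist_pt F).continuousOn
  obtain ⟨x₀, hx₀, hmax'⟩ := hF.isCompact.exists_isMaxOn hF' (Metric.continuous_infDist_pt L).continuousOn
  have hlt1 : Metric.infDist y₀ F < δ := by
    obtain ⟨x, hx, hxy⟩ := Set.mem_iUnion₂.1 (h1 hy₀)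
    exact (Metric.infDist_le_dist_of_mem hx).trans_lt hxy
  have hlt2 : Metric.infDist x₀ L < δ := by
    obtain ⟨y, hy, hxy⟩ := h2 x₀ hx₀
    exact (Metric.infDist_le_dist_of_mem hy).trans_lt hxy
  refine (Metric.hausdorffDist_le_of_infDist (Metric.infDist_nonneg.trans (le_max_left _ _))
    (fun y hy => ?_) fun x hx => ?_).trans_lt (max_lt hlt1 hlt2)
  · exact (hmax hy).trans (le_max_left _ _)
  · exact (hmax' hx).trans (le_max_right _ _)

theorem encard_nonemptyCompacts_subset_le (F : Set X) (n : ℕ) (hF : F.encard ≤ n) :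
    {L : NonemptyCompacts X | (L : Set X) ⊆ F}.encard ≤ (2 ^ n : ℕ) := by
  have hfin : F.Finite := Set.finite_of_encard_le_coe hF
  have h1 : {L : NonemptyCompacts X | (L : Set X) ⊆ F}.encard ≤ (𝒫 F).encard :=
    Set.encard_le_encard_of_injOn (f := fun L => (L : Set X)) (fun L hL => hL)
      (SetLike.coe_injective.injOn)
  refine h1.trans ?_
  have h2 : (𝒫 F).Finite := hfin.powerset
  rw [← h2.cast_ncard_eq, Set.ncard_powerset F hfin]
  rw [← hfin.cast_ncard_eq] at hF
  exact mod_cast Nat.pow_le_pow_right two_pos (mod_cast hF)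

theorem exists_cover_of_coverNumber_le {E : Set X} {δ : ℝ≥0} {n : ℕ} (h : coverNumber E δ ≤ n) :
    ∃ F : Set X, E ⊆ ⋃ x ∈ F, Metric.ball x (δ : ℝ) ∧ F.encard ≤ n := by
  have h' : coverNumber E δ < (n + 1 : ℕ) := h.trans_lt (mod_cast Nat.lt_succ_self n)
  obtain ⟨F, hF⟩ := iInf_lt_iff.1 h'
  obtain ⟨hEF, hF⟩ := iInf_lt_iff.1 hF
  exact ⟨F, hEF, Order.le_of_lt_add_one (by exact_mod_cast hF)⟩

theorem coverNumber_hyperspace_le {E : Set X} {δ : ℝ≥0} {n : ℕ} (h : coverNumber E δ ≤ n) :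
    coverNumber (hyperspace E) δ ≤ (2 ^ n : ℕ) := by
  obtain ⟨F, hEF, hFn⟩ := exists_cover_of_coverNumber_le h
  refine (iInf₂_le _ ?_).trans (encard_nonemptyCompacts_subset_le F n hFn)
  intro L hL
  set F' : Set X := {x ∈ F | ∃ y ∈ (L : Set X), dist x y < δ} with hF'
  have hfin : F'.Finite := (Set.finite_of_encard_le_coe hFn).subset (Set.sep_subset _ _)
  have hcov : (L : Set X) ⊆ ⋃ x ∈ F', Metric.ball x δ := by
    intro y hy
    obtain ⟨x, hx, hxy⟩ := Set.mem_iUnion₂.1 (hEF (hL hy))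
    exact Set.mem_iUnion₂.2 ⟨x, ⟨hx, y, hy, Metric.mem_ball'.1 hxy⟩, hxy⟩
  have hne : F'.Nonempty := by
    obtain ⟨y, hy⟩ := L.nonempty
    obtain ⟨x, hx, -⟩ := Set.mem_iUnion₂.1 (hcov hy)
    exact ⟨x, hx⟩
  refine Set.mem_iUnion₂.2 ⟨⟨⟨F', hfin.isCompact⟩, hne⟩, Set.sep_subset _ _, ?_⟩
  exact hausdorffDist_lt_of_subset_biUnion L.isCompact L.nonempty hfin hcov fun x hx => hx.2

/-- Once `n * φ s δ ≤ 1/2`, the product `2^n * 2^(-1/φ s δ)` is at most `2^(-1/(2 φ s δ))`, which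
tends to 0; the index `s` does not change. -/
theorem upperMinkowskiDim_jump_hyperspace_le {φ : ℝ≥0 → ℝ≥0 → ℝ≥0} (hφ : IsGaugeFamily φ)
    (E : Set X) : upperMinkowskiDim (jump φ) (hyperspace E) ≤ upperMinkowskiDim φ E := by
  refine le_iInf₂ fun s hs => le_iInf fun h => ?_
  refine (iInf₂_le s hs).trans (iInf_le _ (Tendsto.limsup_eq ?_))
  have h := tendsto_zero_of_limsup_eq_zero h
  refine tendsto_of_tendsto_of_tendsto_of_le_of_le' tendsto_const_nhds
    (hφ.jump_tendsto_zero hs (c := 1 / 2) (by norm_num)) (Eventually.of_forall fun _ => bot_le) ?_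
  filter_upwards [h.eventually_le_const (u := ((1 / 2 : ℝ≥0) : ℝ≥0∞)) (by simp),
    self_mem_nhdsWithin] with δ hN hδ
  have hp := hφ.pos hs hδ
  have htop : coverNumber E δ ≠ ⊤ := by
    intro htop
    rw [htop, ENat.toENNReal_top, ENNReal.top_mul (by simpa using hp.ne')] at hN
    exact ENNReal.coe_ne_top (top_le_iff.1 hN)
  obtain ⟨n, hn⟩ := ENat.ne_top_iff_exists.1 htop
  have hle := coverNumber_hyperspace_le hn.ge
  rw [← hn] at hN
  have hN' : (n : ℝ) * φ s δ ≤ 1 / 2 := by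
    rw [ENat.toENNReal_coe] at hN
    have : (n : ℝ≥0) * φ s δ ≤ 1 / 2 := by exact_mod_cast hN
    exact_mod_cast this
  calc (coverNumber (hyperspace E) δ : ℝ≥0∞) * jump φ s δ
      ≤ ENNReal.ofReal (2 ^ (n : ℝ)) * ENNReal.ofReal ((2 : ℝ) ^ (-(1 / φ s δ : ℝ))) := by
        rw [coe_jump_eq_ofReal hp]
        gcongr
        refine (ENat.toENNReal_le.2 hle).trans ?_
        rw [ENat.toENNReal_coe, Real.rpow_natCast, ENNReal.ofReal_pow zero_le_two]
        simp
    _ = ENNReal.ofReal (2 ^ ((n : ℝ) - 1 / φ s δ)) := by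
        rw [← ENNReal.ofReal_mul (by positivity), ← Real.rpow_add two_pos, ← sub_eq_add_neg]
    _ ≤ _ := by
        refine ENNReal.ofReal_le_ofReal (Real.rpow_le_rpow_of_exponent_le one_le_two ?_)
        have hp' : (0 : ℝ) < φ s δ := mod_cast hp
        have : (n : ℝ) ≤ 1 / 2 / φ s δ := (le_div_iff₀ hp').2 hN'
        push_cast
        have e : 1 / (φ s δ : ℝ) = 2 * (1 / 2 / φ s δ) := by field_simp
        linarith

end

/-! ### Separated sets, localization and Baire category. -/

section

variable {Y : Type*} [MetricSpace Y]

/-- Greedy choice: balls around fewer than `n` points cannot cover `A`. -/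
theorem exists_separated_of_le_coverNumber {A : Set Y} {δ : ℝ≥0} (hδ : 0 < δ) (n : ℕ)
    (h : (n : ℕ∞) ≤ coverNumber A δ) :
    ∃ S : Finset Y, (S : Set Y) ⊆ A ∧ S.card = n ∧
      (S : Set Y).Pairwise fun x y => (δ : ℝ) ≤ dist x y := by
  classical
  induction n with
  | zero => exact ⟨∅, by simp⟩
  | succ n ih =>
    obtain ⟨S, hSA, hS, hsep⟩ := ih (le_trans (by exact_mod_cast n.le_succ) h)
    have hnot : ¬ A ⊆ ⋃ x ∈ (S : Set Y), Metric.ball x (δ : ℝ) := by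
      intro hcov
      have h1 : coverNumber A δ ≤ (S : Set Y).encard := iInf₂_le (S : Set Y) hcov
      rw [Set.encard_coe_eq_coe_finsetCard, hS] at h1
      exact absurd (h.trans h1) (by exact_mod_cast Nat.not_succ_le_self n)
    obtain ⟨x, hxA, hx⟩ := Set.not_subset.1 hnot
    simp only [Set.mem_iUnion, exists_prop, not_and, Metric.mem_ball, not_exists, not_lt] at hx
    have hxS : x ∉ S := fun hc => absurd ((hx x hc).trans (dist_self x).le) (not_le.2 (mod_cast hδ))
    refine ⟨insert x S, ?_, by rw [Finset.card_insert_of_notMem hxS, hS], ?_⟩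
    · rw [Finset.coe_insert]
      exact Set.insert_subset hxA hSA
    · rw [Finset.coe_insert]
      refine hsep.insert fun y hy _ => ⟨hx y hy, ?_⟩
      rw [dist_comm]
      exact hx y hy

theorem card_mul_le_packingSup {U : Set Y} {T : Finset Y} (hT : (T : Set Y) ⊆ U) {r δ : ℝ≥0}
    (hr : 0 < r) (hδ : 2 * r ≤ δ)
    (hsep : (T : Set Y).Pairwise fun x y => ((2 * r : ℝ≥0) : ℝ) ≤ dist x y) (g : ℝ≥0 → ℝ≥0) :
    (T.card : ℝ≥0∞) * g (2 * r) ≤ packingSup g δ U := by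
  have hinj : Function.Injective fun x : Y => (x, r) := fun x y h => (Prod.mk.inj h).1
  set C : Set (Y × ℝ≥0) := (fun x => (x, r)) '' (T : Set Y) with hC
  have hpack : IsBallPacking U δ C := by
    refine ⟨(T.countable_toSet.image _), ?_, ?_, ?_, ?_⟩
    · rintro _ ⟨x, hx, rfl⟩; exact hT hx
    · rintro _ ⟨x, hx, rfl⟩; exact hr
    · rintro _ ⟨x, hx, rfl⟩; exact hδ
    · rintro _ ⟨x, hx, rfl⟩ _ ⟨y, hy, rfl⟩ hxy
      refine Metric.ball_disjoint_ball ?_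
      have := hsep hx hy fun h => hxy (by rw [h])
      push_cast at this
      linarith
  refine le_trans (le_of_eq ?_) (le_iSup₂_of_le C hpack le_rfl)
  have e : ∀ p : C, (g (2 * p.1.2) : ℝ≥0∞) = g (2 * r) := by
    rintro ⟨_, x, hx, rfl⟩; rfl
  rw [tsum_congr e, ENNReal.tsum_set_const, hC, hinj.encard_image,
    Set.encard_coe_eq_coe_finsetCard, ENat.toENNReal_coe]

/-- Moving each point by less than `r` into `U` costs at most `2r` of the `4r` separation. -/
theorem card_mul_le_packingSup_of_subset_closure {U : Set Y} {T : Finset Y}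
    (hT : (T : Set Y) ⊆ closure U) {r δ : ℝ≥0} (hr : 0 < r) (hδ : 2 * r ≤ δ)
    (hsep : (T : Set Y).Pairwise fun x y => ((4 * r : ℝ≥0) : ℝ) ≤ dist x y) (g : ℝ≥0 → ℝ≥0) :
    (T.card : ℝ≥0∞) * g (2 * r) ≤ packingSup g δ U := by
  classical
  have hr' : (0 : ℝ) < r := mod_cast hr
  have h : ∀ x : Y, ∃ y, x ∈ T → y ∈ U ∧ dist x y < r := fun x => by
    by_cases hx : x ∈ T
    · obtain ⟨y, hy⟩ := Metric.mem_closure_iff.1 (hT hx) r hr'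
      exact ⟨y, fun _ => hy⟩
    · exact ⟨x, fun h => absurd h hx⟩
  choose f hf using h
  have key : ∀ x ∈ T, ∀ y ∈ T, x ≠ y → ((2 * r : ℝ≥0) : ℝ) ≤ dist (f x) (f y) := by
    intro x hx y hy hxy
    have h1 := hsep hx hy hxy
    have h2 := dist_triangle4_right x y (f x) (f y)
    have h3 := (hf x hx).2
    have h4 := (hf y hy).2
    push_cast at h1 ⊢
    linarith
  have hinj : Set.InjOn f T := by
    intro x hx y hy hxy
    by_contra hne
    have := key x hx y hy hne
    rw [hxy, dist_self] at this
    push_cast at this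
    linarith
  rw [← Finset.card_image_of_injOn hinj]
  refine card_mul_le_packingSup ?_ hr hδ ?_ g
  · rw [Finset.coe_image]
    rintro _ ⟨x, hx, rfl⟩
    exact (hf x hx).1
  · rw [Finset.coe_image]
    rintro _ ⟨x, hx, rfl⟩ _ ⟨y, hy, rfl⟩ hxy
    exact key x hx y hy fun h => hxy (by rw [h])

/-- The sets `L ∪ A`, for `A` ranging over the subsets of a separated set away from `L`, form a
separated family of the hyperspace. -/
theorem exists_separated_nonemptyCompacts {L S : Finset Y} (hL : L.Nonempty) {δ : ℝ}
    (hδ : 0 < δ) (hsep : (S : Set Y).Pairwise fun x y => δ ≤ dist x y) :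
    ∃ (m : ℕ) (T : Finset (NonemptyCompacts Y)), S.card ≤ L.card + m ∧ T.card = 2 ^ m ∧
      (∀ K ∈ T, ∃ A ⊆ S, (K : Set Y) = ↑L ∪ ↑A) ∧
      (T : Set (NonemptyCompacts Y)).Pairwise fun x y => δ / 2 ≤ dist x y := by
  classical
  set S' := S.filter fun x => ∀ z ∈ L, δ / 2 ≤ dist x z with hS'
  have hS'S : S' ⊆ S := Finset.filter_subset _ _
  -- By the separation of `S`, each point of `L` is within `δ / 2` of at most one point of `S`.
  have hcard : (S \ S').card ≤ L.card := by
    have h : ∀ x ∈ S \ S', ∃ z ∈ L, dist x z < δ / 2 := by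
      intro x hx
      obtain ⟨h1, h2⟩ := Finset.mem_sdiff.1 hx
      by_contra! hc
      exact h2 (Finset.mem_filter.2 ⟨h1, hc⟩)
    refine Finset.card_le_card_of_forall_subsingleton (fun x z => dist x z < δ / 2) h ?_
    rintro z - x ⟨hx, hxz⟩ y ⟨hy, hyz⟩
    by_contra hne
    have := hsep (Finset.mem_sdiff.1 hx).1 (Finset.mem_sdiff.1 hy).1 hne
    have := dist_triangle_right x y z
    linarith
  let c : Finset Y → NonemptyCompacts Y := fun A =>
    ⟨⟨((L ∪ A : Finset Y) : Set Y), (L ∪ A).finite_toSet.isCompact⟩, by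
      obtain ⟨x, hx⟩ := hL
      exact ⟨x, by simp [hx]⟩⟩
  have hc : ∀ A, (c A : Set Y) = ↑L ∪ ↑A := fun A => Finset.coe_union L A
  -- A point of `A` outside `B` is at least `δ / 2` from `L` and at least `δ` from `B`.
  have aux : ∀ A ⊆ S', ∀ B ⊆ S', dist (c A) (c B) < δ / 2 → A ⊆ B := by
    intro A hA B hB hd x hx
    rw [Metric.NonemptyCompacts.dist_eq] at hd
    obtain ⟨y, hy, hxy⟩ := Metric.exists_dist_lt_of_hausdorffDist_lt (x := x)
      (by rw [hc]; exact Or.inr hx) hd (Metric.hausdorffEDist_ne_top_of_nonempty_of_bounded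
        (c A).nonempty (c B).nonempty (c A).isCompact.isBounded (c B).isCompact.isBounded)
    rw [hc] at hy
    rcases hy with hy | hy
    · exact absurd hxy (not_lt.2 ((Finset.mem_filter.1 (hA hx)).2 y hy))
    · by_contra hxB
      have hne : x ≠ y := fun h => hxB (h ▸ hy)
      have := hsep (hS'S (hA hx)) (hS'S (hB hy)) hne
      linarith
  have key : ∀ A ⊆ S', ∀ B ⊆ S', A ≠ B → δ / 2 ≤ dist (c A) (c B) := by
    intro A hA B hB hne
    by_contra! hd
    exact hne ((aux A hA B hB hd).antisymm (aux B hB A hA (by rwa [dist_comm])))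
  have hinj : Set.InjOn c (S'.powerset : Set (Finset Y)) := by
    intro A hA B hB hAB
    by_contra hne
    have := key A (Finset.mem_powerset.1 hA) B (Finset.mem_powerset.1 hB) hne
    rw [hAB, dist_self] at this
    linarith
  refine ⟨S'.card, S'.powerset.image c, ?_, ?_, ?_, ?_⟩
  · have := Finset.card_sdiff_add_card_eq_card hS'S
    omega
  · rw [Finset.card_image_of_injOn hinj, Finset.card_powerset]
  · intro K hK
    obtain ⟨A, hA, rfl⟩ := Finset.mem_image.1 hK
    exact ⟨A, (Finset.mem_powerset.1 hA).trans hS'S, hc A⟩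
  · rw [Finset.coe_image]
    rintro _ ⟨A, hA, rfl⟩ _ ⟨B, hB, rfl⟩ hAB
    exact key A (Finset.mem_powerset.1 hA) B (Finset.mem_powerset.1 hB) fun h => hAB (by rw [h])

theorem coverNumber_mono {A B : Set Y} (h : A ⊆ B) (δ : ℝ≥0) : coverNumber A δ ≤ coverNumber B δ :=
  le_iInf₂ fun F hF => iInf₂_le_of_le F (h.trans hF) le_rfl

theorem coverNumber_union_le (A B : Set Y) (δ : ℝ≥0) :
    coverNumber (A ∪ B) δ ≤ coverNumber A δ + coverNumber B δ := by
  by_cases hA : coverNumber A δ = ⊤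
  · simp [hA]
  by_cases hB : coverNumber B δ = ⊤
  · simp [hB]
  obtain ⟨n, hn⟩ := ENat.ne_top_iff_exists.1 hA
  obtain ⟨m, hm⟩ := ENat.ne_top_iff_exists.1 hB
  obtain ⟨F, hAF, hF⟩ := exists_cover_of_coverNumber_le hn.ge
  obtain ⟨G, hBG, hG⟩ := exists_cover_of_coverNumber_le hm.ge
  rw [← hn, ← hm]
  refine (iInf₂_le (F ∪ G) ?_).trans ((Set.encard_union_le F G).trans (add_le_add hF hG))
  rw [Set.biUnion_union]
  exact Set.union_subset_union hAF hBG

/-- Convergence to 0 passes to subsets and finite unions, so if it held locally it would hold on the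
compact set `E`. -/
theorem IsCompact.exists_forall_nhdsWithin_not_tendsto {E : Set Y} (hE : IsCompact E)
    {g : ℝ≥0 → ℝ≥0}
    (h : ¬ Tendsto (fun δ : ℝ≥0 => (coverNumber E δ : ℝ≥0∞) * (g δ : ℝ≥0∞)) (𝓝[>] 0) (𝓝 0)) :
    ∃ p ∈ E, ∀ V ∈ 𝓝[E] p,
      ¬ Tendsto (fun δ : ℝ≥0 => (coverNumber V δ : ℝ≥0∞) * (g δ : ℝ≥0∞)) (𝓝[>] 0) (𝓝 0) := by
  by_contra! hc
  refine h (hE.induction_on (p := fun V => Tendsto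
    (fun δ : ℝ≥0 => (coverNumber V δ : ℝ≥0∞) * (g δ : ℝ≥0∞)) (𝓝[>] 0) (𝓝 0)) ?_ ?_ ?_ hc)
  · have : ∀ δ, coverNumber (∅ : Set Y) δ = 0 := fun δ =>
      le_antisymm (iInf₂_le_of_le ∅ (Set.empty_subset _) Set.encard_empty.le) bot_le
    simp [this]
  · intro A B hAB hB
    refine tendsto_of_tendsto_of_tendsto_of_le_of_le tendsto_const_nhds hB (fun _ => bot_le)
      fun δ => ?_
    exact mul_le_mul_left (ENat.toENNReal_le.2 (coverNumber_mono hAB δ)) _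
  · intro A B hA hB
    have hAB := hA.add hB
    rw [add_zero] at hAB
    refine tendsto_of_tendsto_of_tendsto_of_le_of_le tendsto_const_nhds hAB (fun _ => bot_le)
      fun δ => ?_
    simp only
    rw [← add_mul, ← ENat.toENNReal_add]
    exact mul_le_mul_left (ENat.toENNReal_le.2 (coverNumber_union_le A B δ)) _

theorem IsCompact.exists_ball_inter_subset_closure {K : Set Y} (hK : IsCompact K)
    (hne : K.Nonempty) {𝒰 : Set (Set Y)} (h𝒰 : 𝒰.Countable) (hcov : K ⊆ ⋃₀ 𝒰) :
    ∃ U ∈ 𝒰, ∃ z ∈ K, ∃ ρ > 0, ∀ w ∈ K, dist w z < ρ → w ∈ closure U := by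
  have : CompactSpace K := isCompact_iff_compactSpace.1 hK
  have : Nonempty K := hne.to_subtype
  have : Countable 𝒰 := h𝒰.to_subtype
  obtain ⟨U, z, hz⟩ := nonempty_interior_of_iUnion_of_closed
    (f := fun U : 𝒰 => (Subtype.val ⁻¹' closure U.1 : Set K))
    (fun U => isClosed_closure.preimage continuous_subtype_val) (by
      refine Set.eq_univ_of_forall fun w => ?_
      obtain ⟨U, hU, hw⟩ := hcov w.2
      exact Set.mem_iUnion.2 ⟨⟨U, hU⟩, subset_closure hw⟩)
  obtain ⟨ρ, hρ, hball⟩ := Metric.mem_nhds_iff.1 (mem_interior_iff_mem_nhds.1 hz)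
  exact ⟨U.1, U.2, z.1, z.2, ρ, hρ, fun w hw hd => hball (show (⟨w, hw⟩ : K) ∈ _ from hd)⟩

end

/-! ### Lower bound for the packing dimension of the hyperspace. -/

section

variable {φ : ℝ≥0 → ℝ≥0 → ℝ≥0}

/-- With `s < u < v < t`, each halving of the scale costs one index step, and the last step gives
the little-o. -/
theorem IsGaugeFamily.isLittleO_div_four (hφ : IsGaugeFamily φ) (hdbl : IsDoublingFamily φ)
    {s t : ℝ≥0} (hs : 0 < s) (hst : s < t) :
    (fun δ : ℝ≥0 => (φ t δ : ℝ)) =o[𝓝[>] 0] fun δ : ℝ≥0 => (φ s (δ / 4) : ℝ) := by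
  obtain ⟨u, hsu, hut⟩ := exists_between hst
  obtain ⟨v, huv, hvt⟩ := exists_between hut
  have hu := hs.trans hsu
  have hdiv : ∀ c : ℝ≥0, 0 < c → Tendsto (fun δ : ℝ≥0 => δ / c) (𝓝[>] 0) (𝓝[>] 0) := by
    intro c hc
    refine tendsto_nhdsWithin_iff.2 ⟨?_, ?_⟩
    · have : Tendsto (fun δ : ℝ≥0 => δ / c) (𝓝 0) (𝓝 (0 / c)) := tendsto_id.div_const c
      rw [zero_div] at this
      exact this.mono_left nhdsWithin_le_nhds
    · filter_upwards [self_mem_nhdsWithin] with δ hδ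
      exact div_pos hδ hc
  have h1 := (hdbl u v hu huv).comp_tendsto (hdiv 2 two_pos)
  have h2 := (hdbl s u hs hsu).comp_tendsto (hdiv 4 four_pos)
  have e1 : ∀ δ : ℝ≥0, 2 * (δ / 2) = δ := fun δ => mul_div_cancel₀ _ two_ne_zero
  have e2 : ∀ δ : ℝ≥0, 2 * (δ / 4) = δ / 2 := fun δ => by
    rw [show (4 : ℝ≥0) = 2 * 2 by norm_num, ← div_div, e1]
  simp only [Function.comp_def, e1] at h1
  simp only [Function.comp_def, e2] at h2
  exact (hφ.isLittleO t v (hu.trans huv) hvt).trans_isBigO (h1.trans h2)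

end

section

variable {X : Type*} [MetricSpace X] {φ : ℝ≥0 → ℝ≥0 → ℝ≥0}

theorem exists_nat_le_and_lt_mul {N : ℕ∞} {c x : ℝ≥0} (hx : 0 < x)
    (h : (c : ℝ≥0∞) < (N : ℝ≥0∞) * x) : ∃ n : ℕ, (n : ℕ∞) ≤ N ∧ c < n * x := by
  induction N using ENat.recTopCoe with
  | top =>
    obtain ⟨n, hn⟩ := exists_nat_gt (c / x)
    exact ⟨n, le_top, (div_lt_iff₀ hx).1 hn⟩
  | coe n =>
    refine ⟨n, le_rfl, ?_⟩
    rw [ENat.toENNReal_coe] at h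
    exact_mod_cast h

/-- If `U` is dense near `L₀` in the compact subsets of `E` containing `p`, and the covering numbers
of `E` near `p` are large, then the packings of `U` are large. -/
theorem one_le_packingPremeasure_jump (hφ : IsGaugeFamily φ) (hdbl : IsDoublingFamily φ)
    {s t : ℝ≥0} (hs : 0 < s) (hst : s < t) {E : Set X} {p : X}
    (hbad : ∀ V ∈ 𝓝[E] p,
      ¬ Tendsto (fun δ : ℝ≥0 => (coverNumber V δ : ℝ≥0∞) * (φ t δ : ℝ≥0∞)) (𝓝[>] 0) (𝓝 0))
    {L₀ : NonemptyCompacts X} (hL₀ : (L₀ : Set X) ⊆ E) (hpL₀ : p ∈ (L₀ : Set X))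
    {ρ : ℝ} (hρ : 0 < ρ) {U : Set (NonemptyCompacts X)}
    (hU : ∀ K : NonemptyCompacts X, (K : Set X) ⊆ E → p ∈ (K : Set X) → dist K L₀ < ρ →
      K ∈ closure U) :
    1 ≤ packingPremeasure (jump φ s) U := by
  classical
  have ht := hs.trans hst
  refine le_iInf₂ fun δ₀ hδ₀ => ?_
  obtain ⟨F, hFL₀, hF, hcov⟩ := L₀.isCompact.finite_cover_balls (half_pos hρ)
  -- The net is fixed before `δ`, so its cardinality is negligible against `c / φ t δ`.
  set L : Finset X := insert p hF.toFinset with hL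
  have hLL₀ : (L : Set X) ⊆ L₀ := by
    rw [hL, Finset.coe_insert, hF.coe_toFinset]
    exact Set.insert_subset hpL₀ hFL₀
  set V : Set X := E ∩ Metric.ball p (ρ / 2) with hV
  have hVnhds : V ∈ 𝓝[E] p :=
    Filter.inter_mem self_mem_nhdsWithin
      (mem_nhdsWithin_of_mem_nhds (Metric.ball_mem_nhds p (half_pos hρ)))
  have hnear : ∀ (K : NonemptyCompacts X) (A : Finset X), (A : Set X) ⊆ V →
      (K : Set X) = ↑L ∪ ↑A → K ∈ closure U := by
    intro K A hA hK
    have hpK : p ∈ (K : Set X) := by rw [hK]; left; simp [hL]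
    refine hU K ?_ hpK ?_
    · rw [hK]
      exact Set.union_subset (hLL₀.trans hL₀) fun x hx => (hA hx).1
    · rw [Metric.NonemptyCompacts.dist_eq]
      refine (Metric.hausdorffDist_le_of_mem_dist (half_pos hρ).le ?_ ?_).trans_lt (half_lt_self hρ)
      · intro x hx
        rw [hK] at hx
        rcases hx with hx | hx
        · exact ⟨x, hLL₀ hx, by rw [dist_self]; exact (half_pos hρ).le⟩
        · exact ⟨p, hpL₀, (Metric.mem_ball.1 (hA hx).2).le⟩
      · intro x hx
        obtain ⟨y, hy, hxy⟩ := Set.mem_iUnion₂.1 (hcov hx)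
        refine ⟨y, ?_, (Metric.mem_ball.1 hxy).le⟩
        rw [hK]
        left
        simp [hL, hy]
  obtain ⟨c, hc, hfreq⟩ : ∃ c : ℝ≥0, 0 < c ∧
      ∃ᶠ δ : ℝ≥0 in 𝓝[>] 0, (c : ℝ≥0∞) < (coverNumber V δ : ℝ≥0∞) * (φ t δ : ℝ≥0∞) := by
    have h := hbad V hVnhds
    rw [ENNReal.tendsto_nhds_zero] at h
    push Not at h
    obtain ⟨ε, hε, h⟩ := h
    obtain ⟨c, hc, hcε⟩ := ENNReal.lt_iff_exists_nnreal_btwn.1 hε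
    exact ⟨c, by simpa using hc, h.mono fun δ hδ => hcε.trans hδ⟩
  have hc' : (0 : ℝ) < c := mod_cast hc
  have ev1 := (hφ.isLittleO_div_four hdbl hs hst).bound (half_pos hc')
  have ev2 : ∀ᶠ δ in 𝓝[>] (0 : ℝ≥0), (L.card : ℝ) * φ t δ ≤ c / 2 := by
    have h := (hφ.tendsto_zero ht).const_mul (L.card : ℝ)
    rw [mul_zero] at h
    exact h.eventually_le_const (half_pos hc')
  have ev3 : ∀ᶠ δ in 𝓝[>] (0 : ℝ≥0), δ ≤ δ₀ :=
    mem_nhdsWithin_of_mem_nhds (Iic_mem_nhds hδ₀)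
  obtain ⟨δ, hN, h1, h2, h3, hδ⟩ :=
    (hfreq.and_eventually (ev1.and (ev2.and (ev3.and self_mem_nhdsWithin)))).exists
  have hδ : 0 < δ := hδ
  obtain ⟨n, hn, hcn⟩ := exists_nat_le_and_lt_mul (hφ.pos ht hδ) hN
  obtain ⟨S, hSV, hSn, hsep⟩ := exists_separated_of_le_coverNumber hδ n hn
  obtain ⟨m, T, hm, hT, hTS, hTsep⟩ :=
    exists_separated_nonemptyCompacts (L := L) ⟨p, by simp [hL]⟩ (mod_cast hδ : (0 : ℝ) < δ) hsep
  have hTU : (T : Set (NonemptyCompacts X)) ⊆ closure U := by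
    intro K hK
    obtain ⟨A, hA, hKA⟩ := hTS K hK
    exact hnear K A (Set.Subset.trans (Finset.coe_subset.2 hA) hSV) hKA
  have e : 2 * (δ / 8) = δ / 4 := by
    rw [show (8 : ℝ≥0) = 4 * 2 by norm_num, ← div_div]
    exact mul_div_cancel₀ _ two_ne_zero
  -- The separation of `T` is `δ / 2 = 4 * (δ / 8)`; the balls have diameter `δ / 4`.
  have hpack := card_mul_le_packingSup_of_subset_closure hTU (r := δ / 8) (δ := δ₀) (by positivity)
    (by rw [e]; exact (div_le_self bot_le (by norm_num)).trans h3)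
    (hTsep.mono' fun x y hxy => by push_cast; linarith) (jump φ s)
  refine le_trans ?_ hpack
  have hq := hφ.pos hs (show 0 < δ / 4 by positivity)
  have hq' : (0 : ℝ) < φ s (δ / 4) := mod_cast hq
  have ht' : (0 : ℝ) < φ t δ := mod_cast hφ.pos ht hδ
  have hm' : 1 / (φ s (δ / 4) : ℝ) ≤ m := by
    rw [div_le_iff₀ hq']
    have hcn' : (c : ℝ) < n * φ t δ := mod_cast hcn
    have hnm : (n : ℝ) ≤ L.card + m := by rw [← hSn]; exact_mod_cast hm
    have h4 : (n : ℝ) * φ t δ ≤ (L.card + m) * φ t δ := mul_le_mul_of_nonneg_right hnm ht'.le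
    simp only [NNReal.norm_eq] at h1
    have h5 : (c : ℝ) / 2 ≤ m * (c / 2 * φ s (δ / 4)) :=
      le_trans (by linarith) (mul_le_mul_of_nonneg_left h1 (Nat.cast_nonneg m))
    have h6 : (c : ℝ) / 2 * 1 ≤ c / 2 * (m * φ s (δ / 4)) := by linarith
    exact le_of_mul_le_mul_left h6 (half_pos hc')
  rw [e, hT, coe_jump_eq_ofReal hq]
  have h2m : (((2 ^ m : ℕ)) : ℝ≥0∞) = ENNReal.ofReal (2 ^ (m : ℝ)) := by
    rw [Real.rpow_natCast, ENNReal.ofReal_pow zero_le_two]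
    simp
  rw [h2m, ← ENNReal.ofReal_mul (by positivity), ← Real.rpow_add two_pos, ENNReal.one_le_ofReal]
  exact Real.one_le_rpow one_le_two (by linarith)

theorem upperMinkowskiDim_le_packingDim_jump_hyperspace (hφ : IsGaugeFamily φ)
    (hdbl : IsDoublingFamily φ) {E : Set X} (hE : IsCompact E) :
    upperMinkowskiDim φ E ≤ packingDim (jump φ) (hyperspace E) := by
  refine le_iInf₂ fun s hs => le_iInf fun h => upperMinkowskiDim_le_of_forall_gt fun t hst => ?_
  by_contra hnot
  obtain ⟨p, hp, hbad⟩ := hE.exists_forall_nhdsWithin_not_tendsto hnot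
  have hlt : packingMeasure (jump φ s) (hyperspace E) < 1 := h ▸ zero_lt_one
  simp only [packingMeasure, iInf_lt_iff] at hlt
  obtain ⟨𝒰, h𝒰, hcov, hsum⟩ := hlt
  -- Requiring `p` as a member ensures that whichever `L₀` Baire provides can absorb points near `p`
  -- with little Hausdorff displacement.
  set K : Set (NonemptyCompacts X) := {L | (L : Set X) ⊆ E} ∩ {L | ((L : Set X) ∩ {p}).Nonempty}
  have hK : IsCompact K := (NonemptyCompacts.isCompact_subsets_of_isCompact hE).inter_right
    (NonemptyCompacts.isClosed_inter_nonempty_of_isClosed isClosed_singleton)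
  have hKne : K.Nonempty := ⟨{p}, by simpa using hp, by simp⟩
  obtain ⟨U, hU, L₀, hL₀, ρ, hρ, hball⟩ := hK.exists_ball_inter_subset_closure hKne h𝒰
    (Set.inter_subset_left.trans hcov)
  have h1 := one_le_packingPremeasure_jump hφ hdbl hs hst hbad hL₀.1
    (Set.inter_singleton_nonempty.1 hL₀.2) hρ
    fun L hLE hpL hd => hball L ⟨hLE, Set.inter_singleton_nonempty.2 hpL⟩ hd
  exact absurd hsum (not_lt.2 (h1.trans
    (ENNReal.le_tsum (f := fun U : 𝒰 => packingPremeasure (jump φ s) U.1) ⟨U, hU⟩)))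

end

theorem mainTheorem3 {X : Type*} [MetricSpace X] [SeparableSpace X]
    (E : Set X) (hE : IsCompact E)
    (φ : ℝ≥0 → ℝ≥0 → ℝ≥0) (hφ : IsGaugeFamily φ) (hdbl : IsDoublingFamily φ)
    (hprec : ∃ α : ℝ≥0 → ℕ → ℚ≥0, IsPrecisionFamily φ α) :
    packingDim (jump φ) (hyperspace E) = upperMinkowskiDim (jump φ) (hyperspace E) := by
  obtain ⟨α, hα⟩ := hprec
  exact le_antisymm (packingDim_jump_le_upperMinkowskiDim hφ hdbl hα _)
    ((upperMinkowskiDim_jump_hyperspace_le hφ E).trans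
      (upperMinkowskiDim_le_packingDim_jump_hyperspace hφ hdbl hE))
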